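/- For a submanifold $M\subseteq\mathbb{R}^d$, let $\operatorname{Sym}(M)=\{A\in\operatorname{GL}(d):AM=M\}$, and let $\mathfrak{sym}(M)\subseteq\mathbb{R}^{d\times d}$ be its Lie algebra, i.e. the subspace of all matrices $f'(0)$, where $f$ is a differentiable function from an open interval containing $0$ to $\operatorname{Sym}(M)$ with $f(0)=\operatorname{id}$. For $x\in M$ let $T_xM$ be the tangent space (the set of velocities at $x$ of differentiable curves in $M$ through $x$) and put $S_xM=\{A\in\mathbb{R}^{d\times d}:Ax\in T_xM\}$. Define $$n^\star(M)=\frac{\operatorname{codim}\mathfrak{sym}(M)}{\operatorname{codim}M},$$ where $\operatorname{codim}\mathfrak{sym}(M)$ is taken in $\mathbb{R}^{d\times d}$ and $\operatorname{codim}M$ in $\mathbb{R}^d$, and let $n^\circ(M)\in\mathbb{N}\cup\{\infty\}$ be the infimum of all $n\in\mathbb{N}$ for which there is an open dense subset $O$ of $M^n$ such that $\mathfrak{sym}(M)=\bigcap_{i=1}^n S_{x_i}M$ for every $(x_1,\dots,x_n)\in O$. **Theorem.** Let $Q\in\mathbb{R}^{d\times d}$ be symmetric of full rank, and let $M=\{x\in\mathbb{R}^d:x^\top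 Qx=1\}$. (a) $M$ is empty if and only if $Q$ is negative definite. (b) Otherwise, $M$ is a smooth embedded submanifold of $\mathbb{R}^d$ of codimension $1$, and $$n^\circ(M)=n^\star(M)=\binom{d+1}{2};$$ in particular, there is an open dense set of tuples $(x_1,\dots,x_n)\in M^n$ with $n=\binom{d+1}{2}$ for which $\mathfrak{sym}(M)=\bigcap_{i=1}^n S_{x_i}M$. Moreover, $\operatorname{Sym}(M)=\{A\in\operatorname{GL}(d):A^\top QA=Q\}$, and this group is conjugate in $\operatorname{GL}(d)$ to an indefinite orthogonal group: there are $p\in\{1,\dots,d\}$, $q=d-p$, and $Z\in\operatorname{GL}(d)$ such that $Z^\top QZ=J:=\operatorname{diag}(\mathbf{1}_p,-\mathbf{1}_q)$ and $\operatorname{Sym}(M)=Z\,\operatorname{O}(p,q)\,Z^{-1}$, where $\operatorname{O}(p,q)=\{A\in\operatorname{GL}(d):A^\top JA=J\}$. -/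

import Mathlib

open Set Topology Matrix
open scoped ContDiff

namespace LiePCA

/-!
Points of `ℝ^d` are functions `Fin d → ℝ`.  Only the topology and the differentiable structure of
`ℝ^d` are used below, so the choice of a norm is irrelevant.
-/

/-- The velocities `γ'(0)` of differentiable curves `γ : (a, b) → S` with `a < 0 < b` and
`γ(0) = p`. -/
def velocities {V : Type*} [AddCommGroup V] [Module ℝ V] [TopologicalSpace V]
    [IsTopologicalAddGroup V] [ContinuousSMul ℝ V] (S : Set V) (p : V) : Set V :=
  {v | ∃ (a b : ℝ) (γ : ℝ → V), a < 0 ∧ 0 < b ∧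
    (∀ t ∈ Ioo a b, γ t ∈ S ∧ DifferentiableAt ℝ γ t) ∧ γ 0 = p ∧ HasDerivAt γ v 0}

/-- The symmetry group `Sym(M) = {A ∈ GL(d) : A M = M}`. -/
def symmetryGroup {d : ℕ} (M : Set (Fin d → ℝ)) : Subgroup (GL (Fin d) ℝ) where
  carrier := {A | (fun x => A.val *ᵥ x) '' M = M}
  one_mem' := by simp
  mul_mem' := by
    intro A B hA hB
    simp only [mem_ofPred_eq] at hA hB ⊢
    conv_rhs => rw [← hA, ← hB, image_image]
    simp [Matrix.mulVec_mulVec]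
  inv_mem' := by
    intro A hA
    simp only [mem_ofPred_eq] at hA ⊢
    conv_lhs => rw [← hA, image_image]
    have h : ∀ x : Fin d → ℝ, (A⁻¹).val *ᵥ (A.val *ᵥ x) = x := by
      intro x
      rw [Matrix.mulVec_mulVec, ← Units.val_mul, inv_mul_cancel]
      simp
    simp only [h, image_id']

/-- `Sym(M)` as a set of `d × d` matrices. -/
def symmetryMatrices {d : ℕ} (M : Set (Fin d → ℝ)) : Set (Matrix (Fin d) (Fin d) ℝ) :=
  (fun A : GL (Fin d) ℝ => A.val) '' (symmetryGroup M : Set (GL (Fin d) ℝ))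

section MatrixCurves

attribute [local instance] Matrix.linftyOpNormedRing Matrix.linftyOpNormedAlgebra

lemma hasDerivAt_mul {d : ℕ} {f g : ℝ → Matrix (Fin d) (Fin d) ℝ}
    {f' g' : Matrix (Fin d) (Fin d) ℝ} {t : ℝ} (hf : HasDerivAt f f' t) (hg : HasDerivAt g g' t) :
    HasDerivAt (fun s => f s * g s) (f' * g t + f t * g') t :=
  HasDerivAt.mul hf hg

lemma hasDerivAt_comp_mul {d : ℕ} {f : ℝ → Matrix (Fin d) (Fin d) ℝ}
    {f' : Matrix (Fin d) (Fin d) ℝ} {c t : ℝ} (hf : HasDerivAt f f' (c * t)) :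
    HasDerivAt (fun s => f (c * s)) (c • f') t := by
  have h : HasDerivAt (fun s : ℝ => c * s) c t := by
    simpa using (hasDerivAt_id t).const_mul c
  exact HasDerivAt.scomp t hf h

lemma hasDerivAt_one {d : ℕ} (t : ℝ) :
    HasDerivAt (fun _ : ℝ => (1 : Matrix (Fin d) (Fin d) ℝ)) 0 t :=
  hasDerivAt_const t (1 : Matrix (Fin d) (Fin d) ℝ)

lemma hasDerivAt_deriv {d : ℕ} {f : ℝ → Matrix (Fin d) (Fin d) ℝ} {t : ℝ}
    (hf : DifferentiableAt ℝ f t) : HasDerivAt f (deriv f t) t :=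
  DifferentiableAt.hasDerivAt hf

end MatrixCurves

/-- The Lie algebra `𝔰𝔶𝔪(M)` of `Sym(M)`: all matrices `f'(0)`, where `f` is a differentiable
function from an open interval around `0` to `Sym(M)` with `f(0) = id`. -/
def symmetryAlgebra {d : ℕ} (M : Set (Fin d → ℝ)) :
    Submodule ℝ (Matrix (Fin d) (Fin d) ℝ) where
  carrier := velocities (symmetryMatrices M) 1
  zero_mem' := by
    refine ⟨-1, 1, fun _ => 1, by norm_num, by norm_num, fun t _ => ⟨?_, ?_⟩, rfl,
      hasDerivAt_one 0⟩
    · exact ⟨1, (symmetryGroup M).one_mem, rfl⟩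
    · exact ⟨_, hasDerivAt_one t⟩
  add_mem' := by
    rintro X Y ⟨a, b, f, ha, hb, hf, hf0, hX⟩ ⟨a', b', g, ha', hb', hg, hg0, hY⟩
    refine ⟨max a a', min b b', fun t => f t * g t, max_lt ha ha', lt_min hb hb',
      fun t ht => ?_, by simp [hf0, hg0], ?_⟩
    · obtain ⟨⟨A, hA, hA'⟩, hfd⟩ := hf t
        ⟨(le_max_left _ _).trans_lt ht.1, ht.2.trans_le (min_le_left _ _)⟩
      obtain ⟨⟨B, hB, hB'⟩, hgd⟩ := hg t
        ⟨(le_max_right _ _).trans_lt ht.1, ht.2.trans_le (min_le_right _ _)⟩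
      refine ⟨⟨A * B, (symmetryGroup M).mul_mem hA hB, ?_⟩,
        ⟨_, hasDerivAt_mul (hasDerivAt_deriv hfd) (hasDerivAt_deriv hgd)⟩⟩
      simp only [← hA', ← hB', Units.val_mul]
    · simpa [hf0, hg0] using hasDerivAt_mul hX hY
  smul_mem' := by
    rintro c X ⟨a, b, f, ha, hb, hf, hf0, hX⟩
    have hopen : IsOpen ((fun t : ℝ => c * t) ⁻¹' Ioo a b) :=
      isOpen_Ioo.preimage (continuous_const.mul continuous_id)
    obtain ⟨ε, hε, hball⟩ := Metric.isOpen_iff.1 hopen 0 (by simp [ha, hb])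
    refine ⟨-ε, ε, fun t => f (c * t), by linarith, hε, fun t ht => ?_, by simp [hf0],
      hasDerivAt_comp_mul (by simpa using hX)⟩
    have hct : c * t ∈ Ioo a b := hball (by
      rw [Metric.mem_ball, Real.dist_eq, sub_zero]; exact abs_lt.2 ht)
    exact ⟨(hf _ hct).1, ⟨_, hasDerivAt_comp_mul (hasDerivAt_deriv (hf _ hct).2)⟩⟩

/-- The tangent space `T_x M` of a submanifold `M` of `ℝ^d` at `x ∈ M`. -/
def tangentSpace {d : ℕ} (M : Set (Fin d → ℝ)) (x : Fin d → ℝ) : Set (Fin d → ℝ) :=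
  velocities M x

/-- `S_x M = {A ∈ ℝ^{d × d} : A x ∈ T_x M}`. -/
def tangentMatrices {d : ℕ} (M : Set (Fin d → ℝ)) (x : Fin d → ℝ) :
    Set (Matrix (Fin d) (Fin d) ℝ) :=
  {A | A *ᵥ x ∈ tangentSpace M x}

/-- `M` is a smooth embedded submanifold of `ℝ^d` of codimension `c`: near each of its points it
is the zero set of a smooth `ℝ^c`-valued function with surjective derivative. -/
def IsSubmanifoldOfCodim {d : ℕ} (M : Set (Fin d → ℝ)) (c : ℕ) : Prop :=
  ∀ x ∈ M, ∃ (U : Set (Fin d → ℝ)) (f : (Fin d → ℝ) → (Fin c → ℝ)),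
    IsOpen U ∧ x ∈ U ∧ ContDiffOn ℝ ∞ f U ∧
    (∀ y ∈ U, Function.Surjective (fderiv ℝ f y)) ∧ M ∩ U = {y ∈ U | f y = 0}

/-- The codimension of a nonempty submanifold `M` of `ℝ^d` (the `c` is then unique). -/
noncomputable def codim {d : ℕ} (M : Set (Fin d → ℝ)) : ℕ :=
  sInf {c | IsSubmanifoldOfCodim M c}

/-- `n*(M) = codim 𝔰𝔶𝔪(M) / codim M`. -/
noncomputable def nStar {d : ℕ} (M : Set (Fin d → ℝ)) : ℚ :=
  (Module.finrank ℝ (Matrix (Fin d) (Fin d) ℝ ⧸ symmetryAlgebra M) : ℚ) / (codim M : ℚ)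

/-- There is an open dense set `O ⊆ M^n` such that every tuple `(x_1, …, x_n) ∈ O` satisfies
`𝔰𝔶𝔪(M) = ⋂ i, S_{x_i} M`. -/
def GenericallyDetermines {d : ℕ} (M : Set (Fin d → ℝ)) (n : ℕ) : Prop :=
  ∃ O : Set (Fin n → M), IsOpen O ∧ Dense O ∧
    ∀ x ∈ O, (symmetryAlgebra M : Set (Matrix (Fin d) (Fin d) ℝ)) =
      ⋂ i, tangentMatrices M (x i)

/-- `n°(M)`: the infimum of all `n ∈ ℕ` for which generic `n`-tuples in `M` determine `𝔰𝔶𝔪(M)`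
(it is `∞` if there are none). -/
noncomputable def nCirc {d : ℕ} (M : Set (Fin d → ℝ)) : ℕ∞ :=
  ⨅ n ∈ {n : ℕ | GenericallyDetermines M n}, (n : ℕ∞)

/-- The quadric `{x ∈ ℝ^d : xᵀ Q x = 1}`. -/
def quadric {d : ℕ} (Q : Matrix (Fin d) (Fin d) ℝ) : Set (Fin d → ℝ) :=
  {x | x ⬝ᵥ (Q *ᵥ x) = 1}

/-- The group `{A ∈ GL(d) : Aᵀ Q A = Q}` of the bilinear form `(x, y) ↦ xᵀ Q y`. -/
def isometryGroup {d : ℕ} (Q : Matrix (Fin d) (Fin d) ℝ) : Subgroup (GL (Fin d) ℝ) where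
  carrier := {A | A.valᵀ * Q * A.val = Q}
  one_mem' := by simp
  mul_mem' := by
    intro A B hA hB
    simp only [mem_ofPred_eq, Units.val_mul, Matrix.transpose_mul] at hA hB ⊢
    calc B.valᵀ * A.valᵀ * Q * (A.val * B.val) = B.valᵀ * (A.valᵀ * Q * A.val) * B.val := by
          simp only [Matrix.mul_assoc]
      _ = Q := by rw [hA, hB]
  inv_mem' := by
    intro A hA
    simp only [mem_ofPred_eq] at hA ⊢
    have h : A.val * (A⁻¹).val = 1 := by rw [← Units.val_mul, mul_inv_cancel]; rfl
    calc (A⁻¹).valᵀ * Q * (A⁻¹).val = (A⁻¹).valᵀ * (A.valᵀ * Q * A.val) * (A⁻¹).val := by rw [hA]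
      _ = (A.val * (A⁻¹).val)ᵀ * Q * (A.val * (A⁻¹).val) := by
          simp only [Matrix.transpose_mul, Matrix.mul_assoc]
      _ = Q := by rw [h]; simp

/-- The diagonal `d × d` matrix whose first `p` diagonal entries are `1` and whose other ones
are `-1`. -/
def signatureMatrix (d p : ℕ) : Matrix (Fin d) (Fin d) ℝ :=
  Matrix.diagonal fun i => if (i : ℕ) < p then 1 else -1

/-- The indefinite orthogonal group `O(p, q)` with `q = d - p`, for `p ≤ d`. -/
def indefiniteOrthogonalGroup (d p : ℕ) : Subgroup (GL (Fin d) ℝ) :=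
  isometryGroup (signatureMatrix d p)

end LiePCA

/-!
Write `q(x) = xᵀ Q x` and `M = {q = 1}`. The argument rests on one fact about `M`: a quadratic form
vanishing on a nonempty relatively open subset of `M` is zero
(`Matrix.IsSymm.eq_zero_of_isOpen_inter_quadric`), because by homogeneity it vanishes on an open
cone.

For `A ∈ Sym(M)` the form `q(A x) - q(x)` vanishes on `M`, so `Aᵀ Q A = Q`
(`symmetryGroup_quadric`). As `T_x M = {v | xᵀ Q v = 0}`, a matrix `A` lies in `S_x M` iff the
symmetric matrix `σ(A) = Q A + (Q A)ᵀ` satisfies `xᵀ σ(A) x = 0`. Every element of `𝔰𝔶𝔪(M)` lies in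
`S_x M` for all `x ∈ M`, hence satisfies `σ(A) = 0`; conversely `σ(A) = 0` makes `exp (t A)` a
curve in `Sym(M)`. So `𝔰𝔶𝔪(M) = ker σ` (`mem_symmetryAlgebra_quadric`), and since `Q` is
invertible, `σ` maps onto the symmetric matrices, a space of dimension `N = C(d+1, 2)`. This gives
`n*(M) = N`.

Consequently `x_1, …, x_n` determine `𝔰𝔶𝔪(M)` iff no nonzero symmetric `S` satisfies
`x_iᵀ S x_i = 0` for all `i`. Fewer than `N` linear conditions always leave a nonzero `S`
(`exists_isSymm_ne_zero_of_lt`), and `N` points suffice once the matrices `x_i x_iᵀ` are linearly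
independent (`eq_zero_of_linearIndependent_vecMulVec`). The latter is an open condition, and a
dense one: given open subsets of `M`, the points can be chosen from them one at a time, each off
the zero set of a nonzero form that vanishes at the points chosen before
(`exists_linearIndependent_vecMulVec`). So `n°(M) = N`.

The normal form of `Q` comes from the spectral theorem
(`exists_transpose_mul_mul_eq_signatureMatrix`). If `p = 0` then `Q` is negative definite and `M` is
empty, and otherwise `M` contains the first column of `Z`.
-/

namespace LiePCA

variable {d : ℕ}

/-! ### Symmetric matrices -/

/-- The space of symmetric `d × d` matrices. -/
def symmetricMatrices (d : ℕ) : Submodule ℝ (Matrix (Fin d) (Fin d) ℝ) where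
  carrier := {S | S.IsSymm}
  zero_mem' := Matrix.isSymm_zero
  add_mem' hS hT := Matrix.IsSymm.add hS hT
  smul_mem' c _ hS := Matrix.IsSymm.smul hS c

lemma mem_symmetricMatrices {S : Matrix (Fin d) (Fin d) ℝ} :
    S ∈ symmetricMatrices d ↔ S.IsSymm :=
  Iff.rfl

/-- A symmetric matrix is a function on unordered pairs of indices. -/
def symmetricMatricesEquiv (d : ℕ) : symmetricMatrices d ≃ₗ[ℝ] (Sym2 (Fin d) → ℝ) where
  toFun S := Sym2.lift ⟨fun i j => S.1 i j, fun i j => (S.2.apply i j).symm⟩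
  invFun f := ⟨Matrix.of fun i j => f s(i, j), by
    refine Matrix.IsSymm.ext fun i j => ?_
    simp [Sym2.eq_swap]⟩
  map_add' S T := by
    ext z
    induction z with | _ i j => simp
  map_smul' c S := by
    ext z
    induction z with | _ i j => simp
  left_inv S := by
    ext i j
    simp
  right_inv f := by
    ext z
    induction z with | _ i j => simp

lemma finrank_symmetricMatrices (d : ℕ) :
    Module.finrank ℝ (symmetricMatrices d) = (d + 1).choose 2 := by
  rw [(symmetricMatricesEquiv d).finrank_eq, Module.finrank_fintype_fun_eq_card, Sym2.card,
    Fintype.card_fin]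

lemma _root_.Matrix.IsSymm.dotProduct_mulVec_comm {S : Matrix (Fin d) (Fin d) ℝ} (hS : S.IsSymm)
    (x y : Fin d → ℝ) : x ⬝ᵥ (S *ᵥ y) = y ⬝ᵥ (S *ᵥ x) := by
  rw [Matrix.dotProduct_mulVec, ← Matrix.mulVec_transpose, hS.eq, dotProduct_comm]

lemma _root_.Matrix.IsSymm.dotProduct_mulVec_add_smul {S : Matrix (Fin d) (Fin d) ℝ}
    (hS : S.IsSymm) (x y : Fin d → ℝ) (t : ℝ) :
    (x + t • y) ⬝ᵥ (S *ᵥ (x + t • y)) =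
      x ⬝ᵥ (S *ᵥ x) + 2 * t * (x ⬝ᵥ (S *ᵥ y)) + t ^ 2 * (y ⬝ᵥ (S *ᵥ y)) := by
  simp only [Matrix.mulVec_add, Matrix.mulVec_smul, dotProduct_add, add_dotProduct,
    dotProduct_smul, smul_dotProduct, smul_eq_mul, hS.dotProduct_mulVec_comm y x]
  ring

lemma dotProduct_mulVec_smul_smul (S : Matrix (Fin d) (Fin d) ℝ) (c : ℝ) (x : Fin d → ℝ) :
    (c • x) ⬝ᵥ (S *ᵥ (c • x)) = c ^ 2 * (x ⬝ᵥ (S *ᵥ x)) := by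
  simp only [Matrix.mulVec_smul, dotProduct_smul, smul_dotProduct, smul_eq_mul]
  ring

lemma continuous_dotProduct_mulVec_self (S : Matrix (Fin d) (Fin d) ℝ) :
    Continuous fun x : Fin d → ℝ => x ⬝ᵥ (S *ᵥ x) :=
  continuous_id.dotProduct (continuous_const.matrix_mulVec continuous_id)

lemma _root_.Matrix.IsSymm.eq_zero_of_forall_dotProduct {S : Matrix (Fin d) (Fin d) ℝ}
    (hS : S.IsSymm) (h : ∀ x, x ⬝ᵥ (S *ᵥ x) = 0) : S = 0 := by
  refine Matrix.ext_of_mulVec_single fun j => ?_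
  ext i
  have := hS.dotProduct_mulVec_add_smul (Pi.single i 1) (Pi.single j 1) 1
  rw [h, h, h] at this
  simpa using this

/-- A quadratic form vanishing on a nonempty open set is zero. -/
lemma _root_.Matrix.IsSymm.eq_zero_of_isOpen {S : Matrix (Fin d) (Fin d) ℝ} (hS : S.IsSymm)
    {V : Set (Fin d → ℝ)} (hV : IsOpen V) (hne : V.Nonempty)
    (h : ∀ x ∈ V, x ⬝ᵥ (S *ᵥ x) = 0) : S = 0 := by
  obtain ⟨x, hx⟩ := hne
  refine hS.eq_zero_of_forall_dotProduct fun y => ?_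
  have hc : Continuous fun t : ℝ => x + t • y := by fun_prop
  have hev : ∀ᶠ t : ℝ in 𝓝 0, x + t • y ∈ V :=
    hc.continuousAt.eventually_mem (by simpa using hV.mem_nhds hx)
  obtain ⟨ε, hε, hball⟩ := Metric.eventually_nhds_iff.1 hev
  have key : ∀ t : ℝ, |t| < ε → 2 * t * (x ⬝ᵥ (S *ᵥ y)) + t ^ 2 * (y ⬝ᵥ (S *ᵥ y)) = 0 := by
    intro t ht
    have h1 := h _ (hball (y := t) (by simpa [Real.dist_eq] using ht))
    rw [hS.dotProduct_mulVec_add_smul, h x hx, zero_add] at h1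
    exact h1
  -- Averaging over `t = ± ε / 2` removes the term linear in `t`.
  have h1 := key (ε / 2) (by rw [abs_of_pos (by positivity)]; linarith)
  have h2 := key (-(ε / 2)) (by rw [abs_neg, abs_of_pos (by positivity)]; linarith)
  have h3 : (ε / 2) ^ 2 * (y ⬝ᵥ (S *ᵥ y)) = 0 := by linear_combination (h1 + h2) / 2
  exact (mul_eq_zero.1 h3).resolve_left (by positivity)

lemma trace_mul_vecMulVec_self (S : Matrix (Fin d) (Fin d) ℝ) (x : Fin d → ℝ) :
    (S * Matrix.vecMulVec x x).trace = x ⬝ᵥ (S *ᵥ x) := by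
  rw [Matrix.mul_vecMulVec, Matrix.trace_vecMulVec, dotProduct_comm]

/-! ### Tuples of points and their rank-one matrices -/

/-- If `C(d+1, 2)` points have linearly independent matrices `x xᵀ`, then these matrices span the
symmetric matrices, so a symmetric `S` orthogonal to all of them is orthogonal to itself. -/
lemma eq_zero_of_linearIndependent_vecMulVec {x : Fin ((d + 1).choose 2) → Fin d → ℝ}
    (hx : LinearIndependent ℝ fun i => Matrix.vecMulVec (x i) (x i))
    {S : Matrix (Fin d) (Fin d) ℝ} (hS : S.IsSymm) (h : ∀ i, x i ⬝ᵥ (S *ᵥ x i) = 0) : S = 0 := by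
  have hle : Submodule.span ℝ (range fun i => Matrix.vecMulVec (x i) (x i)) ≤
      symmetricMatrices d := by
    rw [Submodule.span_le]
    rintro _ ⟨i, rfl⟩
    exact Matrix.transpose_vecMulVec _ _
  have heq := Submodule.eq_of_le_of_finrank_eq hle (by
    rw [finrank_span_eq_card hx, finrank_symmetricMatrices, Fintype.card_fin])
  let φ : Matrix (Fin d) (Fin d) ℝ →ₗ[ℝ] ℝ :=
    Matrix.traceLinearMap (Fin d) ℝ ℝ ∘ₗ LinearMap.mulLeft ℝ S
  have hker : symmetricMatrices d ≤ LinearMap.ker φ := by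
    rw [← heq, Submodule.span_le]
    rintro _ ⟨i, rfl⟩
    simpa [φ, trace_mul_vecMulVec_self] using h i
  have hSS : (Sᴴ * S).trace = 0 := by
    have : (S * S).trace = 0 := hker (mem_symmetricMatrices.2 hS)
    rwa [Matrix.conjTranspose_eq_transpose_of_trivial, hS.eq]
  exact Matrix.trace_conjTranspose_mul_self_eq_zero_iff.1 hSS

/-- Any tuple of fewer than `C(d+1, 2)` points lies on the zero set of a nonzero quadratic form. -/
lemma exists_isSymm_ne_zero_of_lt {n : ℕ} (hn : n < (d + 1).choose 2) (x : Fin n → Fin d → ℝ) :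
    ∃ S : Matrix (Fin d) (Fin d) ℝ, S.IsSymm ∧ S ≠ 0 ∧ ∀ i, x i ⬝ᵥ (S *ᵥ x i) = 0 := by
  let L : symmetricMatrices d →ₗ[ℝ] (Fin n → ℝ) :=
    { toFun := fun S i => x i ⬝ᵥ (S.1 *ᵥ x i)
      map_add' := fun S T => by ext i; simp [Matrix.add_mulVec, dotProduct_add]
      map_smul' := fun c S => by ext i; simp [Matrix.smul_mulVec, dotProduct_smul] }
  have hL : LinearMap.ker L ≠ ⊥ := L.ker_ne_bot_of_finrank_lt (by
    rwa [finrank_symmetricMatrices, Module.finrank_fin_fun])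
  obtain ⟨S, hS, hS0⟩ := Submodule.exists_mem_ne_zero_of_ne_bot hL
  exact ⟨S.1, S.2, fun h => hS0 (Subtype.ext h), fun i => congrFun (LinearMap.mem_ker.1 hS) i⟩

/-- If no nonzero quadratic form vanishes on any of the sets `U i`, then points with linearly
independent matrices `x xᵀ` can be chosen from them one after the other. -/
lemma exists_linearIndependent_vecMulVec {n : ℕ} (hn : n ≤ (d + 1).choose 2)
    (U : Fin n → Set (Fin d → ℝ))
    (hU : ∀ i (S : Matrix (Fin d) (Fin d) ℝ), S.IsSymm → (∀ x ∈ U i, x ⬝ᵥ (S *ᵥ x) = 0) → S = 0) :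
    ∃ x : Fin n → Fin d → ℝ, (∀ i, x i ∈ U i) ∧
      LinearIndependent ℝ fun i => Matrix.vecMulVec (x i) (x i) := by
  induction n with
  | zero => exact ⟨Fin.elim0, fun i => i.elim0, linearIndependent_empty_type⟩
  | succ n ih =>
    obtain ⟨x, hx, hli⟩ := ih (by omega) (fun i => U i.succ) fun i => hU i.succ
    -- The new point is taken off the zero set of a form vanishing at the old ones; the functional
    -- `B ↦ tr (S B)` then separates its matrix from their span.
    obtain ⟨S, hS, hS0, hSx⟩ := exists_isSymm_ne_zero_of_lt (by omega) x
    obtain ⟨y, hy, hSy⟩ : ∃ y ∈ U 0, y ⬝ᵥ (S *ᵥ y) ≠ 0 := by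
      by_contra! hcon
      exact hS0 (hU 0 S hS hcon)
    refine ⟨Fin.cons y x, Fin.cases hy hx, ?_⟩
    have hcons : (fun i => Matrix.vecMulVec ((Fin.cons y x : Fin (n + 1) → Fin d → ℝ) i)
        ((Fin.cons y x : Fin (n + 1) → Fin d → ℝ) i)) =
        Fin.cons (Matrix.vecMulVec y y) fun i => Matrix.vecMulVec (x i) (x i) := by
      funext i
      refine Fin.cases ?_ (fun i => ?_) i <;> simp
    rw [hcons, linearIndependent_finCons]
    refine ⟨hli, fun hmem => hSy ?_⟩
    let φ : Matrix (Fin d) (Fin d) ℝ →ₗ[ℝ] ℝ :=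
      Matrix.traceLinearMap (Fin d) ℝ ℝ ∘ₗ LinearMap.mulLeft ℝ S
    have hle : Submodule.span ℝ (range fun i => Matrix.vecMulVec (x i) (x i)) ≤
        LinearMap.ker φ := by
      rw [Submodule.span_le]
      rintro _ ⟨i, rfl⟩
      simpa [φ, trace_mul_vecMulVec_self] using hSx i
    simpa [φ, trace_mul_vecMulVec_self] using hle hmem

section Norm

attribute [local instance] Matrix.linftyOpNormedAddCommGroup Matrix.linftyOpNormedSpace

lemma isOpen_linearIndependent_vecMulVec (n : ℕ) :
    IsOpen {x : Fin n → Fin d → ℝ |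
      LinearIndependent ℝ fun i => Matrix.vecMulVec (x i) (x i)} := by
  have hc : Continuous fun (x : Fin n → Fin d → ℝ) (i : Fin n) => Matrix.vecMulVec (x i) (x i) :=
    continuous_pi fun i => (continuous_apply i).matrix_vecMulVec (continuous_apply i)
  exact isOpen_setOfPred_linearIndependent.preimage hc

end Norm

/-! ### Diagonalization -/

lemma _root_.Matrix.isUnit_of_rank_eq {A : Matrix (Fin d) (Fin d) ℝ} (h : A.rank = d) :
    IsUnit A := by
  rw [← Matrix.mulVec_surjective_iff_isUnit]
  have : LinearMap.range A.mulVecLin = ⊤ :=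
    Submodule.eq_top_of_finrank_eq (by rw [Module.finrank_fin_fun]; exact h)
  exact LinearMap.range_eq_top.1 this

/-- An invertible symmetric matrix is congruent to a signature matrix: order the eigenvalues
decreasingly and rescale the eigenvectors. -/
lemma exists_transpose_mul_mul_eq_signatureMatrix {Q : Matrix (Fin d) (Fin d) ℝ}
    (hQ : Q.IsSymm) (hdet : IsUnit Q) :
    ∃ p ≤ d, ∃ Z : GL (Fin d) ℝ, Z.valᵀ * Q * Z.val = signatureMatrix d p := by
  have hH : Q.IsHermitian := by
    rwa [Matrix.IsHermitian, Matrix.conjTranspose_eq_transpose_of_trivial]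
  set U : Matrix (Fin d) (Fin d) ℝ := hH.eigenvectorUnitary.1 with hU
  have hUU : Uᵀ * U = 1 := by
    have := Unitary.coe_star_mul_self hH.eigenvectorUnitary
    rwa [Matrix.star_eq_conjTranspose, Matrix.conjTranspose_eq_transpose_of_trivial] at this
  have hdiag : Uᵀ * Q * U = Matrix.diagonal hH.eigenvalues := by
    have := hH.conjStarAlgAut_star_eigenvectorUnitary
    rw [Unitary.conjStarAlgAut_star_apply, Matrix.star_eq_conjTranspose,
      Matrix.conjTranspose_eq_transpose_of_trivial] at this
    exact this
  have hne : ∀ i, hH.eigenvalues i ≠ 0 := by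
    have h1 : IsUnit (Matrix.diagonal hH.eigenvalues) := by
      rw [← hdiag]
      have hUu : IsUnit U := IsUnit.of_mul_eq_one_right _ hUU
      have hUt : IsUnit Uᵀ := IsUnit.of_mul_eq_one _ hUU
      exact (hUt.mul hdet).mul hUu
    rw [Matrix.isUnit_diagonal] at h1
    exact fun i => (h1.map (Pi.evalMonoidHom _ i)).ne_zero
  -- `Tuple.sort` orders increasingly, hence the sign.
  set σ := Tuple.sort fun i => -hH.eigenvalues i with hσ
  set l : Fin d → ℝ := fun i => hH.eigenvalues (σ i) with hl
  have hanti : Antitone l := fun i j hij => by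
    have := Tuple.monotone_sort (fun i => -hH.eigenvalues i) hij
    simpa using this
  obtain ⟨p, hp, hlp⟩ : ∃ p ≤ d, ∀ i : Fin d, (i : ℕ) < p ↔ 0 < l i := by
    classical
    -- `p` is the least strict bound for the indices of the positive eigenvalues.
    have hex : ∃ p, ∀ i : Fin d, 0 < l i → (i : ℕ) < p := ⟨d, fun i _ => i.2⟩
    refine ⟨Nat.find hex, Nat.find_min' hex fun i _ => i.2, fun i => ⟨fun hi => ?_,
      Nat.find_spec hex i⟩⟩
    by_contra hneg
    refine absurd (Nat.find_min' hex (m := i) fun j hj => ?_) (by omega)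
    by_contra hij
    exact hneg (hj.trans_le (hanti (Fin.le_def.2 (not_lt.1 hij))))
  set c : Fin d → ℝ := fun i => (Real.sqrt |l i|)⁻¹ with hc
  have hcl : ∀ i, c i * l i * c i = if (i : ℕ) < p then 1 else -1 := by
    intro i
    have h0 : 0 < |l i| := abs_pos.2 (hne _)
    have hcc : c i * c i = |l i|⁻¹ := by
      rw [hc, ← mul_inv, Real.mul_self_sqrt h0.le]
    rw [mul_right_comm, hcc]
    split_ifs with hi
    · rw [abs_of_pos ((hlp i).1 hi), inv_mul_cancel₀ (hne _)]
    · rw [abs_of_neg (lt_of_le_of_ne (not_lt.1 fun h => hi ((hlp i).2 h)) (hne _)), inv_neg,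
        neg_mul, inv_mul_cancel₀ (hne _)]
  set Z : Matrix (Fin d) (Fin d) ℝ := U.submatrix id σ * Matrix.diagonal c with hZ
  have hZQ : Zᵀ * Q * Z = signatureMatrix d p := by
    have h1 : (U.submatrix id σ)ᵀ * Q * U.submatrix id σ = Matrix.diagonal l := by
      have : (U.submatrix id σ)ᵀ * Q * U.submatrix id σ = (Uᵀ * Q * U).submatrix σ σ := rfl
      rw [this, hdiag, Matrix.submatrix_diagonal_equiv]
      rfl
    calc Zᵀ * Q * Z = Matrix.diagonal c * ((U.submatrix id σ)ᵀ * Q * U.submatrix id σ) *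
          Matrix.diagonal c := by
          simp only [hZ, Matrix.transpose_mul, Matrix.diagonal_transpose, Matrix.mul_assoc]
      _ = signatureMatrix d p := by
          rw [h1, Matrix.diagonal_mul_diagonal, Matrix.diagonal_mul_diagonal, signatureMatrix]
          congr 1
          exact funext hcl
  have hsig : IsUnit (signatureMatrix d p) := by
    refine IsUnit.of_mul_eq_one (signatureMatrix d p) ?_
    rw [signatureMatrix, Matrix.diagonal_mul_diagonal, ← Matrix.diagonal_one]
    congr 1
    funext i
    split_ifs <;> norm_num
  have hZu : IsUnit Z := by
    rw [Matrix.isUnit_iff_isUnit_det] at hsig ⊢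
    rw [← hZQ, Matrix.det_mul] at hsig
    exact isUnit_of_mul_isUnit_right hsig
  exact ⟨p, hp, hZu.unit, hZQ⟩

/-! ### Quadratic forms on the quadric -/

variable {Q : Matrix (Fin d) (Fin d) ℝ}

lemma mem_quadric {x : Fin d → ℝ} : x ∈ quadric Q ↔ x ⬝ᵥ (Q *ᵥ x) = 1 :=
  Iff.rfl

/-- A quadratic form vanishing on a nonempty relatively open subset of the quadric is zero, since
it vanishes on the open cone over that subset. -/
lemma _root_.Matrix.IsSymm.eq_zero_of_isOpen_inter_quadric {S : Matrix (Fin d) (Fin d) ℝ}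
    (hS : S.IsSymm) {U : Set (Fin d → ℝ)} (hU : IsOpen U) (hne : (U ∩ quadric Q).Nonempty)
    (h : ∀ x ∈ U ∩ quadric Q, x ⬝ᵥ (S *ᵥ x) = 0) : S = 0 := by
  have hq := continuous_dotProduct_mulVec_self Q
  have hpos : IsOpen {y : Fin d → ℝ | 0 < y ⬝ᵥ (Q *ᵥ y)} := isOpen_lt continuous_const hq
  have hcont : ContinuousOn (fun y : Fin d → ℝ => (Real.sqrt (y ⬝ᵥ (Q *ᵥ y)))⁻¹ • y)
      {y : Fin d → ℝ | 0 < y ⬝ᵥ (Q *ᵥ y)} :=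
    (hq.sqrt.continuousOn.inv₀ fun y hy => (Real.sqrt_pos.2 hy).ne').smul continuousOn_id
  refine hS.eq_zero_of_isOpen (hcont.isOpen_inter_preimage hpos hU) ?_ ?_
  · obtain ⟨x, hxU, hxM⟩ := hne
    refine ⟨x, ?_, ?_⟩
    · simp [mem_quadric.1 hxM]
    · simpa [mem_quadric.1 hxM] using hxU
  · rintro y ⟨hy, hyU⟩
    have hy : 0 < y ⬝ᵥ (Q *ᵥ y) := hy
    have hs : 0 < (Real.sqrt (y ⬝ᵥ (Q *ᵥ y)))⁻¹ := inv_pos.2 (Real.sqrt_pos.2 hy)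
    have h0 := h _ ⟨hyU, by
      rw [mem_quadric, dotProduct_mulVec_smul_smul, inv_pow, Real.sq_sqrt hy.le,
        inv_mul_cancel₀ hy.ne']⟩
    rw [dotProduct_mulVec_smul_smul] at h0
    exact (mul_eq_zero.1 h0).resolve_left (pow_pos hs 2).ne'

lemma _root_.Matrix.IsSymm.eq_zero_of_quadric {S : Matrix (Fin d) (Fin d) ℝ}
    (hS : S.IsSymm) (hne : (quadric Q).Nonempty)
    (h : ∀ x ∈ quadric Q, x ⬝ᵥ (S *ᵥ x) = 0) : S = 0 :=
  hS.eq_zero_of_isOpen_inter_quadric isOpen_univ (by simpa using hne) fun x hx => h x hx.2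

lemma dotProduct_mulVec_add_transpose (B : Matrix (Fin d) (Fin d) ℝ) (x : Fin d → ℝ) :
    x ⬝ᵥ ((B + Bᵀ) *ᵥ x) = 2 * (x ⬝ᵥ (B *ᵥ x)) := by
  rw [Matrix.add_mulVec, dotProduct_add, Matrix.mulVec_transpose, dotProduct_comm x (x ᵥ* B),
    ← Matrix.dotProduct_mulVec]
  ring

/-! ### The quadric as a submanifold -/

lemma exists_hasFDerivAt_dotProduct_mulVec (hQ : Q.IsSymm) (x : Fin d → ℝ) :
    ∃ D : (Fin d → ℝ) →L[ℝ] ℝ, (∀ v, D v = 2 * (x ⬝ᵥ (Q *ᵥ v))) ∧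
      HasFDerivAt (fun y : Fin d → ℝ => y ⬝ᵥ (Q *ᵥ y)) D x := by
  let B : (Fin d → ℝ) →L[ℝ] (Fin d → ℝ) →L[ℝ] ℝ :=
    (Matrix.toLinearMap₂' ℝ Q).toContinuousBilinearMap
  have hB : ∀ y z, B y z = y ⬝ᵥ (Q *ᵥ z) := fun y z => Matrix.toLinearMap₂'_apply' Q y z
  have h := B.hasFDerivAt_of_bilinear (hasFDerivAt_id x) (hasFDerivAt_id x)
  simp only [hB, id] at h
  refine ⟨_, fun v => ?_, h⟩
  simp [ContinuousLinearMap.precompR_apply, ContinuousLinearMap.precompL_apply, hB,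
    hQ.dotProduct_mulVec_comm v x]
  ring

lemma contDiff_dotProduct_mulVec (Q : Matrix (Fin d) (Fin d) ℝ) :
    ContDiff ℝ ∞ fun y : Fin d → ℝ => y ⬝ᵥ (Q *ᵥ y) := by
  simp only [dotProduct, Matrix.mulVec]
  fun_prop

lemma ne_zero_of_mem_quadric {x : Fin d → ℝ} (hx : x ∈ quadric Q) : x ≠ 0 := by
  rintro rfl
  simp [mem_quadric] at hx

lemma isSubmanifoldOfCodim_quadric (hQ : Q.IsSymm) (hu : IsUnit Q) :
    IsSubmanifoldOfCodim (quadric Q) 1 := by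
  intro x hx
  refine ⟨{0}ᶜ, fun y _ => y ⬝ᵥ (Q *ᵥ y) - 1, isOpen_compl_singleton, ne_zero_of_mem_quadric hx,
    ?_, ?_, ?_⟩
  · exact (contDiff_pi.2 fun _ => (contDiff_dotProduct_mulVec Q).sub contDiff_const).contDiffOn
  · intro y hy w
    obtain ⟨D, hD, hDq⟩ := exists_hasFDerivAt_dotProduct_mulVec hQ y
    have hF : HasFDerivAt (fun (y : Fin d → ℝ) (_ : Fin 1) => y ⬝ᵥ (Q *ᵥ y) - 1)
        (ContinuousLinearMap.pi fun _ => D) y := hasFDerivAt_pi.2 fun _ => hDq.sub_const 1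
    have hQy : Q *ᵥ y ≠ 0 := fun h0 =>
      hy (Matrix.mulVec_injective_of_isUnit hu (by simpa using h0))
    have hpos : (Q *ᵥ y) ⬝ᵥ (Q *ᵥ y) ≠ 0 := fun h0 => hQy (dotProduct_self_eq_zero.1 h0)
    refine ⟨(w 0 / (2 * ((Q *ᵥ y) ⬝ᵥ (Q *ᵥ y)))) • (Q *ᵥ y), ?_⟩
    rw [hF.fderiv]
    ext i
    rw [ContinuousLinearMap.pi_apply, map_smul, hD, hQ.dotProduct_mulVec_comm y (Q *ᵥ y),
      Fin.eq_zero i, smul_eq_mul]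
    field_simp
  · ext y
    simp only [mem_inter_iff, mem_quadric, mem_compl_iff, mem_singleton_iff, funext_iff,
      Pi.zero_apply, sub_eq_zero, mem_ofPred_eq]
    tauto

/-- The quadric is not open: it meets each ray from the origin in at most one point. -/
lemma not_isSubmanifoldOfCodim_zero_quadric (hne : (quadric Q).Nonempty) :
    ¬ IsSubmanifoldOfCodim (quadric Q) 0 := by
  intro h
  obtain ⟨x, hx⟩ := hne
  obtain ⟨U, f, hU, hxU, -, -, hMU⟩ := h x hx
  have hc : Continuous fun t : ℝ => t • x := by fun_prop
  have hev : ∀ᶠ t : ℝ in 𝓝[>] 1, t • x ∈ U :=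
    (hc.continuousAt.eventually_mem (by simpa using hU.mem_nhds hxU)).filter_mono
      nhdsWithin_le_nhds
  obtain ⟨t, htU, ht⟩ := (hev.and self_mem_nhdsWithin).exists
  have htM : t • x ∈ quadric Q ∩ U := by
    rw [hMU]
    exact ⟨htU, Subsingleton.elim _ _⟩
  have h1 := mem_quadric.1 htM.1
  rw [dotProduct_mulVec_smul_smul, mem_quadric.1 hx] at h1
  have ht : 1 < t := ht
  nlinarith

lemma codim_quadric (hQ : Q.IsSymm) (hu : IsUnit Q) (hne : (quadric Q).Nonempty) :
    codim (quadric Q) = 1 := by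
  have hmem := isSubmanifoldOfCodim_quadric hQ hu
  refine le_antisymm (Nat.sInf_le hmem) (Nat.one_le_iff_ne_zero.2 fun h0 => ?_)
  have : IsSubmanifoldOfCodim (quadric Q) (codim (quadric Q)) :=
    Nat.sInf_mem (s := {c | IsSubmanifoldOfCodim (quadric Q) c}) ⟨1, hmem⟩
  rw [h0] at this
  exact not_isSubmanifoldOfCodim_zero_quadric hne this

/-- The tangent space at `x` is `x^⊥` with respect to the form `Q`; the velocity `v` is attained by
the line `x + t v` rescaled to lie on the quadric. -/
lemma mem_tangentSpace_quadric (hQ : Q.IsSymm) {x v : Fin d → ℝ} (hx : x ∈ quadric Q) :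
    v ∈ tangentSpace (quadric Q) x ↔ x ⬝ᵥ (Q *ᵥ v) = 0 := by
  constructor
  · rintro ⟨a, b, γ, ha, hb, hγ, rfl, hv⟩
    obtain ⟨D, hD, hDq⟩ := exists_hasFDerivAt_dotProduct_mulVec hQ (γ 0)
    have h1 : HasDerivAt (fun t => γ t ⬝ᵥ (Q *ᵥ γ t)) (D v) 0 := hDq.comp_hasDerivAt 0 hv
    have h2 : HasDerivAt (fun t => γ t ⬝ᵥ (Q *ᵥ γ t)) 0 0 := by
      refine (hasDerivAt_const (0 : ℝ) (1 : ℝ)).congr_of_eventuallyEq ?_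
      filter_upwards [Ioo_mem_nhds ha hb] with t ht using (hγ t ht).1
    have h3 := h1.unique h2
    rw [hD] at h3
    linarith
  · intro hv
    -- The form takes the value `1 + t² k` at `x + t v`, which is positive for small `t`.
    set k := v ⬝ᵥ (Q *ᵥ v) with hk
    have hc : Continuous fun t : ℝ => 1 + t ^ 2 * k := by fun_prop
    obtain ⟨ε, hε, hball⟩ := Metric.eventually_nhds_iff.1
      (hc.continuousAt.eventually_mem (x := 0) (Ioi_mem_nhds (a := 0) (by simp)))
    have hpos : ∀ t ∈ Ioo (-ε) ε, 0 < 1 + t ^ 2 * k := fun t ht =>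
      hball (by rw [Real.dist_eq, sub_zero]; exact abs_lt.2 ht)
    have hder : ∀ t ∈ Ioo (-ε) ε, HasDerivAt
        (fun t : ℝ => (Real.sqrt (1 + t ^ 2 * k))⁻¹ • (x + t • v))
        ((Real.sqrt (1 + t ^ 2 * k))⁻¹ • v +
          (-(2 * t * k / (2 * Real.sqrt (1 + t ^ 2 * k))) /
            Real.sqrt (1 + t ^ 2 * k) ^ 2) • (x + t • v)) t := by
      intro t ht
      have h1 : HasDerivAt (fun t : ℝ => 1 + t ^ 2 * k) (2 * t * k) t := by
        simpa using ((hasDerivAt_pow 2 t).mul_const k).const_add 1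
      have h2 := (h1.sqrt (hpos t ht).ne').inv (Real.sqrt_pos.2 (hpos t ht)).ne'
      have h3 : HasDerivAt (fun t : ℝ => x + t • v) v t := by
        simpa using ((hasDerivAt_id t).smul_const v).const_add x
      exact h2.smul h3
    refine ⟨-ε, ε, _, by linarith, hε, fun t ht => ⟨?_, (hder t ht).differentiableAt⟩, ?_, ?_⟩
    · rw [mem_quadric, dotProduct_mulVec_smul_smul, hQ.dotProduct_mulVec_add_smul, hv,
        mem_quadric.1 hx, mul_zero, add_zero, inv_pow, Real.sq_sqrt (hpos t ht).le,
        inv_mul_cancel₀ (hpos t ht).ne']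
    · simp
    · simpa using hder 0 ⟨by linarith, hε⟩

/-! ### The symmetry group and its Lie algebra -/

lemma dotProduct_mulVec_mulVec (A : Matrix (Fin d) (Fin d) ℝ) (x : Fin d → ℝ) :
    (A *ᵥ x) ⬝ᵥ (Q *ᵥ (A *ᵥ x)) = x ⬝ᵥ ((Aᵀ * Q * A) *ᵥ x) := by
  rw [← Matrix.mulVec_mulVec, ← Matrix.mulVec_mulVec, Matrix.dotProduct_mulVec x Aᵀ,
    Matrix.vecMul_transpose]

lemma symmetryGroup_quadric (hQ : Q.IsSymm) (hne : (quadric Q).Nonempty) :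
    symmetryGroup (quadric Q) = isometryGroup Q := by
  have hsub : ∀ A ∈ isometryGroup Q, ∀ x ∈ quadric Q, A.val *ᵥ x ∈ quadric Q := by
    intro A hA x hx
    have hA : A.valᵀ * Q * A.val = Q := hA
    rwa [mem_quadric, dotProduct_mulVec_mulVec, hA]
  ext A
  constructor
  · intro hA
    have hA : (fun x => A.val *ᵥ x) '' quadric Q = quadric Q := hA
    have hsymm : (A.valᵀ * Q * A.val - Q).IsSymm := by
      refine Matrix.IsSymm.sub ?_ hQ
      rw [Matrix.IsSymm, Matrix.transpose_mul, Matrix.transpose_mul, Matrix.transpose_transpose,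
        hQ.eq, Matrix.mul_assoc]
    refine sub_eq_zero.1 (hsymm.eq_zero_of_quadric hne fun x hx => ?_)
    have hAx : A.val *ᵥ x ∈ quadric Q := hA ▸ mem_image_of_mem _ hx
    rw [mem_quadric, dotProduct_mulVec_mulVec] at hAx
    rw [Matrix.sub_mulVec, dotProduct_sub, hAx, mem_quadric.1 hx, sub_self]
  · intro hA
    refine Subset.antisymm ?_ fun y hy => ⟨(A⁻¹).val *ᵥ y, hsub _ (inv_mem hA) y hy, ?_⟩
    · rintro _ ⟨x, hx, rfl⟩
      exact hsub A hA x hx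
    · change A.val *ᵥ ((A⁻¹).val *ᵥ y) = y
      rw [Matrix.mulVec_mulVec, ← Units.val_mul, mul_inv_cancel, Units.val_one, Matrix.one_mulVec]

section Norm

attribute [local instance] Matrix.linftyOpNormedRing Matrix.linftyOpNormedAlgebra

lemma hasDerivAt_mulVec {f : ℝ → Matrix (Fin d) (Fin d) ℝ} {A : Matrix (Fin d) (Fin d) ℝ} {t : ℝ}
    (hf : HasDerivAt f A t) (x : Fin d → ℝ) : HasDerivAt (fun s => f s *ᵥ x) (A *ᵥ x) t :=
  ((LinearMap.toContinuousLinearMap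
    ((Matrix.mulVecBilin ℝ ℝ).flip x)).hasFDerivAt (x := f t)).comp_hasDerivAt t hf

lemma hasDerivAt_exp_smul (A : Matrix (Fin d) (Fin d) ℝ) (t : ℝ) :
    HasDerivAt (fun s : ℝ => NormedSpace.exp (s • A)) (NormedSpace.exp (t • A) * A) t :=
  hasDerivAt_exp_smul_const A t

end Norm

/-- The differential of a curve of symmetries applied to a point of the set is tangent to it. -/
lemma symmetryAlgebra_subset_tangentMatrices {M : Set (Fin d → ℝ)} {x : Fin d → ℝ} (hx : x ∈ M) :
    (symmetryAlgebra M : Set (Matrix (Fin d) (Fin d) ℝ)) ⊆ tangentMatrices M x := by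
  rintro A ⟨a, b, f, ha, hb, hf, hf0, hA⟩
  refine ⟨a, b, fun t => f t *ᵥ x, ha, hb, fun t ht => ⟨?_, ?_⟩, by simp [hf0],
    hasDerivAt_mulVec hA x⟩
  · obtain ⟨B, hB, hBt⟩ := (hf t ht).1
    have hB : (fun x => B.val *ᵥ x) '' M = M := hB
    change f t *ᵥ x ∈ M
    rw [← hBt, ← hB]
    exact mem_image_of_mem _ hx
  · exact (hasDerivAt_mulVec (hasDerivAt_deriv (hf t ht).2) x).differentiableAt

lemma mem_tangentMatrices_quadric (hQ : Q.IsSymm) {x : Fin d → ℝ} (hx : x ∈ quadric Q)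
    {A : Matrix (Fin d) (Fin d) ℝ} :
    A ∈ tangentMatrices (quadric Q) x ↔ x ⬝ᵥ ((Q * A + (Q * A)ᵀ) *ᵥ x) = 0 := by
  rw [dotProduct_mulVec_add_transpose, ← Matrix.mulVec_mulVec, mul_eq_zero_iff_left two_ne_zero]
  exact mem_tangentSpace_quadric hQ hx

lemma exp_smul_mem_symmetryMatrices_quadric (hQ : Q.IsSymm) (hu : IsUnit Q)
    (hne : (quadric Q).Nonempty) {A : Matrix (Fin d) (Fin d) ℝ} (hA : Q * A + (Q * A)ᵀ = 0)
    (t : ℝ) : NormedSpace.exp (t • A) ∈ symmetryMatrices (quadric Q) := by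
  have hunit := Matrix.isUnit_exp (t • A)
  have hdet : IsUnit Q.det := (Matrix.isUnit_iff_isUnit_det Q).1 hu
  refine ⟨hunit.unit, ?_, rfl⟩
  rw [symmetryGroup_quadric hQ hne]
  change (NormedSpace.exp (t • A))ᵀ * Q * NormedSpace.exp (t • A) = Q
  -- `Q A + (Q A)ᵀ = 0` says that `Q` conjugates `-A` into `Aᵀ`, hence `exp (-tA)` into
  -- `exp (tA)ᵀ`.
  have hconj : (t • A)ᵀ = Q * -(t • A) * Q⁻¹ := by
    have h1 : Aᵀ * Q = -(Q * A) := by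
      rw [Matrix.transpose_mul, hQ.eq] at hA
      exact eq_neg_of_add_eq_zero_right hA
    rw [Matrix.mul_neg, Matrix.mul_smul, ← smul_neg, ← h1, Matrix.smul_mul,
      Matrix.mul_nonsing_inv_cancel_right _ _ hdet, Matrix.transpose_smul]
  rw [← Matrix.exp_transpose, hconj, Matrix.exp_conj _ _ hu,
    Matrix.nonsing_inv_mul_cancel_right _ _ hdet, Matrix.mul_assoc, Matrix.exp_neg,
    Matrix.nonsing_inv_mul _ ((Matrix.isUnit_iff_isUnit_det _).1 hunit), Matrix.mul_one]

lemma mem_symmetryAlgebra_quadric (hQ : Q.IsSymm) (hu : IsUnit Q) (hne : (quadric Q).Nonempty)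
    {A : Matrix (Fin d) (Fin d) ℝ} :
    A ∈ symmetryAlgebra (quadric Q) ↔ Q * A + (Q * A)ᵀ = 0 := by
  constructor
  · intro hA
    exact (Matrix.isSymm_add_transpose_self (Q * A)).eq_zero_of_quadric hne fun x hx =>
      (mem_tangentMatrices_quadric hQ hx).1 (symmetryAlgebra_subset_tangentMatrices hx hA)
  · intro hA
    refine ⟨-1, 1, fun t => NormedSpace.exp (t • A), by norm_num, one_pos, fun t _ =>
      ⟨exp_smul_mem_symmetryMatrices_quadric hQ hu hne hA t,
        ⟨_, hasDerivAt_exp_smul A t⟩⟩, ?_, ?_⟩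
    · simp [NormedSpace.exp_zero]
    · simpa [NormedSpace.exp_zero] using hasDerivAt_exp_smul A 0

/-- The map `A ↦ Q A + (Q A)ᵀ` identifies `ℝ^{d × d} / 𝔰𝔶𝔪(M)` with the symmetric matrices. -/
lemma finrank_quotient_symmetryAlgebra_quadric (hQ : Q.IsSymm) (hu : IsUnit Q)
    (hne : (quadric Q).Nonempty) :
    Module.finrank ℝ (Matrix (Fin d) (Fin d) ℝ ⧸ symmetryAlgebra (quadric Q)) =
      (d + 1).choose 2 := by
  let L : Matrix (Fin d) (Fin d) ℝ →ₗ[ℝ] symmetricMatrices d :=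
    { toFun := fun A => ⟨Q * A + (Q * A)ᵀ, Matrix.isSymm_add_transpose_self _⟩
      map_add' := fun A B => Subtype.ext (by
        change Q * (A + B) + (Q * (A + B))ᵀ = Q * A + (Q * A)ᵀ + (Q * B + (Q * B)ᵀ)
        rw [Matrix.mul_add, Matrix.transpose_add]
        abel)
      map_smul' := fun c A => Subtype.ext (by
        change Q * (c • A) + (Q * (c • A))ᵀ = c • (Q * A + (Q * A)ᵀ)
        rw [Matrix.mul_smul, Matrix.transpose_smul, smul_add]) }
  have hker : symmetryAlgebra (quadric Q) = LinearMap.ker L := by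
    ext A
    rw [mem_symmetryAlgebra_quadric hQ hu hne, LinearMap.mem_ker, Subtype.ext_iff]
    rfl
  have hsurj : Function.Surjective L := by
    rintro ⟨S, hS⟩
    refine ⟨Q⁻¹ * ((1 / 2 : ℝ) • S), Subtype.ext ?_⟩
    change Q * (Q⁻¹ * ((1 / 2 : ℝ) • S)) + (Q * (Q⁻¹ * ((1 / 2 : ℝ) • S)))ᵀ = S
    rw [Matrix.mul_nonsing_inv_cancel_left _ _ ((Matrix.isUnit_iff_isUnit_det Q).1 hu),
      Matrix.transpose_smul, (mem_symmetricMatrices.1 hS).eq, ← add_smul]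
    norm_num
  rw [hker, (L.quotKerEquivOfSurjective hsurj).finrank_eq, finrank_symmetricMatrices]

/-! ### Generic tuples -/

lemma dense_linearIndependent_vecMulVec_quadric {n : ℕ} (hn : n ≤ (d + 1).choose 2) :
    Dense {x : Fin n → quadric Q |
      LinearIndependent ℝ fun i => Matrix.vecMulVec (x i).1 (x i).1} := by
  rw [dense_iff_inter_open]
  rintro W hW ⟨a, ha⟩
  obtain ⟨u, hu, huW⟩ := isOpen_pi_iff'.1 hW a ha
  choose U hU hUu using fun i => isOpen_induced_iff.1 (hu i).1
  obtain ⟨x, hxU, hx⟩ := exists_linearIndependent_vecMulVec hn (fun i => U i ∩ quadric Q)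
    fun i S hS => hS.eq_zero_of_isOpen_inter_quadric (hU i)
      ⟨a i, by simpa [← hUu i] using (hu i).2, (a i).2⟩
  refine ⟨fun i => ⟨x i, (hxU i).2⟩, huW fun i _ => ?_, hx⟩
  rw [← hUu i]
  exact (hxU i).1

lemma genericallyDetermines_quadric (hQ : Q.IsSymm) (hu : IsUnit Q) (hne : (quadric Q).Nonempty) :
    GenericallyDetermines (quadric Q) ((d + 1).choose 2) := by
  refine ⟨_, ?_, dense_linearIndependent_vecMulVec_quadric le_rfl, fun x hx => ?_⟩
  · exact (isOpen_linearIndependent_vecMulVec _).preimage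
      (continuous_pi fun i => continuous_subtype_val.comp (continuous_apply i))
  · refine Subset.antisymm
      (subset_iInter fun i => symmetryAlgebra_subset_tangentMatrices (x i).2) fun A hA => ?_
    refine (mem_symmetryAlgebra_quadric hQ hu hne).2 ?_
    exact eq_zero_of_linearIndependent_vecMulVec hx (Matrix.isSymm_add_transpose_self _) fun i =>
      (mem_tangentMatrices_quadric hQ (x i).2).1 (mem_iInter.1 hA i)

lemma not_genericallyDetermines_quadric (hQ : Q.IsSymm) (hu : IsUnit Q)
    (hne : (quadric Q).Nonempty) {n : ℕ} (hn : n < (d + 1).choose 2) :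
    ¬ GenericallyDetermines (quadric Q) n := by
  rintro ⟨O, -, hO, hdet⟩
  have : Nonempty (quadric Q) := hne.to_subtype
  obtain ⟨x, hx⟩ := hO.nonempty
  obtain ⟨S, hS, hS0, hSx⟩ := exists_isSymm_ne_zero_of_lt hn fun i => (x i).1
  -- `Q⁻¹ S` lies in all `S_{x_i} M` but not in the Lie algebra.
  have hQS : Q * (Q⁻¹ * S) + (Q * (Q⁻¹ * S))ᵀ = (2 : ℝ) • S := by
    rw [Matrix.mul_nonsing_inv_cancel_left _ _ ((Matrix.isUnit_iff_isUnit_det Q).1 hu), hS.eq,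
      two_smul]
  have hmem : Q⁻¹ * S ∈ (symmetryAlgebra (quadric Q) : Set (Matrix (Fin d) (Fin d) ℝ)) := by
    rw [hdet x hx]
    refine mem_iInter.2 fun i => (mem_tangentMatrices_quadric hQ (x i).2).2 ?_
    rw [hQS, Matrix.smul_mulVec, dotProduct_smul, hSx, smul_zero]
  have h0 := (mem_symmetryAlgebra_quadric hQ hu hne).1 hmem
  rw [hQS] at h0
  exact hS0 ((smul_eq_zero.1 h0).resolve_left two_ne_zero)

lemma nCirc_quadric (hQ : Q.IsSymm) (hu : IsUnit Q) (hne : (quadric Q).Nonempty) :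
    nCirc (quadric Q) = (((d + 1).choose 2 : ℕ) : ℕ∞) := by
  refine le_antisymm (iInf₂_le _ (genericallyDetermines_quadric hQ hu hne))
    (le_iInf₂ fun n hn => ?_)
  by_contra hlt
  exact not_genericallyDetermines_quadric hQ hu hne (by simpa using hlt) hn

/-! ### Signature -/

lemma quadric_eq_empty_of_posDef_neg (h : (-Q).PosDef) : quadric Q = ∅ := by
  refine eq_empty_of_forall_notMem fun x hx => ?_
  have := h.dotProduct_mulVec_pos (ne_zero_of_mem_quadric hx)
  rw [star_trivial, Matrix.neg_mulVec, dotProduct_neg, mem_quadric.1 hx] at this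
  linarith

lemma nonempty_quadric_of_signature {p : ℕ} (hp : 1 ≤ p) (hpd : p ≤ d) {Z : GL (Fin d) ℝ}
    (hZ : Z.valᵀ * Q * Z.val = signatureMatrix d p) : (quadric Q).Nonempty := by
  refine ⟨Z.val *ᵥ Pi.single ⟨0, by omega⟩ 1, ?_⟩
  rw [mem_quadric, dotProduct_mulVec_mulVec, hZ, signatureMatrix]
  simp [show 0 < p from hp]

lemma one_le_of_signature (hQ : Q.IsSymm) (hneg : ¬ (-Q).PosDef) {p : ℕ} {Z : GL (Fin d) ℝ}
    (hZ : Z.valᵀ * Q * Z.val = signatureMatrix d p) : 1 ≤ p := by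
  by_contra hp
  obtain rfl : p = 0 := by omega
  have hsig : signatureMatrix d 0 = -1 := by
    ext i j
    by_cases hij : i = j <;> simp [signatureMatrix, hij]
  refine hneg (Matrix.PosDef.of_dotProduct_mulVec_pos ?_ fun x hx => ?_)
  · rw [Matrix.IsHermitian, Matrix.conjTranspose_eq_transpose_of_trivial, Matrix.transpose_neg,
      hQ.eq]
  · have hxy : x = Z.val *ᵥ ((Z⁻¹).val *ᵥ x) := by
      rw [Matrix.mulVec_mulVec, ← Units.val_mul, mul_inv_cancel, Units.val_one, Matrix.one_mulVec]
    have hy : (Z⁻¹).val *ᵥ x ≠ 0 := fun h0 => hx (by rw [hxy, h0, Matrix.mulVec_zero])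
    rw [star_trivial, Matrix.neg_mulVec, dotProduct_neg, hxy, dotProduct_mulVec_mulVec, hZ, hsig,
      Matrix.neg_mulVec, dotProduct_neg, neg_neg, Matrix.one_mulVec]
    simpa using dotProduct_star_self_pos_iff.2 hy

lemma mem_isometryGroup_iff_conj {J : Matrix (Fin d) (Fin d) ℝ} {Z : GL (Fin d) ℝ}
    (hZ : Z.valᵀ * Q * Z.val = J) (A : GL (Fin d) ℝ) :
    A ∈ isometryGroup Q ↔ Z⁻¹ * A * Z ∈ isometryGroup J := by
  have hZZ : Z.val * (Z⁻¹).val = 1 := by rw [← Units.val_mul, mul_inv_cancel, Units.val_one]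
  have key : (Z⁻¹ * A * Z).valᵀ * J * (Z⁻¹ * A * Z).val =
      Z.valᵀ * (A.valᵀ * Q * A.val) * Z.val := by
    calc (Z⁻¹ * A * Z).valᵀ * J * (Z⁻¹ * A * Z).val
        = Z.valᵀ * A.valᵀ * (Z.val * (Z⁻¹).val)ᵀ * Q * (Z.val * (Z⁻¹).val) * A.val * Z.val := by
          simp only [← hZ, Units.val_mul, Matrix.transpose_mul, Matrix.mul_assoc]
      _ = Z.valᵀ * (A.valᵀ * Q * A.val) * Z.val := by
          simp only [hZZ, Matrix.transpose_one, Matrix.mul_one, Matrix.mul_assoc]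
  change A.valᵀ * Q * A.val = Q ↔ (Z⁻¹ * A * Z).valᵀ * J * (Z⁻¹ * A * Z).val = J
  rw [key, ← hZ]
  have hZt : IsUnit Z.valᵀ := (Matrix.isUnit_transpose _).2 Z.isUnit
  rw [Z.isUnit.mul_left_inj, hZt.mul_right_inj]

end LiePCA

theorem mainTheorem1 (d : ℕ) (Q : Matrix (Fin d) (Fin d) ℝ) (hQsymm : Q.IsSymm)
    (hQrank : Q.rank = d) :
    (LiePCA.quadric Q = ∅ ↔ (-Q).PosDef) ∧
    (¬ (-Q).PosDef →
      LiePCA.IsSubmanifoldOfCodim (LiePCA.quadric Q) 1 ∧ LiePCA.codim (LiePCA.quadric Q) = 1 ∧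
      LiePCA.nCirc (LiePCA.quadric Q) = ((Nat.choose (d + 1) 2 : ℕ) : ℕ∞) ∧
      LiePCA.nStar (LiePCA.quadric Q) = ((Nat.choose (d + 1) 2 : ℕ) : ℚ) ∧
      LiePCA.GenericallyDetermines (LiePCA.quadric Q) (Nat.choose (d + 1) 2) ∧
      LiePCA.symmetryGroup (LiePCA.quadric Q) = LiePCA.isometryGroup Q ∧
      ∃ p : ℕ, 1 ≤ p ∧ p ≤ d ∧ ∃ Z : GL (Fin d) ℝ,
        Z.valᵀ * Q * Z.val = LiePCA.signatureMatrix d p ∧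
        ∀ A : GL (Fin d) ℝ, A ∈ LiePCA.symmetryGroup (LiePCA.quadric Q) ↔
          Z⁻¹ * A * Z ∈ LiePCA.indefiniteOrthogonalGroup d p) := by
  have hu : IsUnit Q := Matrix.isUnit_of_rank_eq hQrank
  obtain ⟨p, hpd, Z, hZ⟩ := LiePCA.exists_transpose_mul_mul_eq_signatureMatrix hQsymm hu
  have hne : ¬ (-Q).PosDef → (LiePCA.quadric Q).Nonempty := fun hneg =>
    LiePCA.nonempty_quadric_of_signature (LiePCA.one_le_of_signature hQsymm hneg hZ) hpd hZ
  refine ⟨⟨fun h => ?_, LiePCA.quadric_eq_empty_of_posDef_neg⟩, fun hneg => ?_⟩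
  · by_contra hneg
    exact (hne hneg).ne_empty h
  have hM := hne hneg
  have hSym := LiePCA.symmetryGroup_quadric hQsymm hM
  refine ⟨LiePCA.isSubmanifoldOfCodim_quadric hQsymm hu, LiePCA.codim_quadric hQsymm hu hM,
    LiePCA.nCirc_quadric hQsymm hu hM, ?_, LiePCA.genericallyDetermines_quadric hQsymm hu hM, hSym,
    p, LiePCA.one_le_of_signature hQsymm hneg hZ, hpd, Z, hZ, fun A => ?_⟩
  · rw [LiePCA.nStar, LiePCA.codim_quadric hQsymm hu hM,
      LiePCA.finrank_quotient_symmetryAlgebra_quadric hQsymm hu hM, Nat.cast_one, div_one]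
  · rw [hSym, LiePCA.indefiniteOrthogonalGroup]
    exact LiePCA.mem_isometryGroup_iff_conj hZ A
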